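/- Let $\theta_R>0$, $\theta\in[0,\theta_R]$, $0<\omega\le 2\pi/\theta_R$, $P_T>0$ and $\sigma_v^2\ge 0$. Let $\eta_1,\eta_2,\dots$ be i.i.d. real random variables with a symmetric distribution, with (real-valued) characteristic function $\varphi_\eta(t)=\mathrm{E}[e^{jt\eta_i}]$, where $\varphi_\eta(\omega)\neq 0$. Let $h_1,h_2,\dots$ be complex random variables (channel coefficients) whose amplitudes $|h_i|$ are i.i.d., independent of $(\eta_i)$, and satisfy $\mathrm{E}[|h_i|^2]=1$. Let the channel noise $v$ be circularly symmetric complex Gaussian, $v\sim\mathcal{CN}(0,\sigma_v^2)$, independent of $(\eta_i,|h_i|)_i$ ($v$ may be a different such variable for each $L$). With $x_i=\theta+\eta_i$, let the signal received from $L$ sensors over the fading multiple access channel under the total power constraint $P_T$ be $$y_L=\sqrt{\tfrac{P_T}{L}}\sum_{i=1}^L|h_i|\,e^{j\omega x_i}+v,\qquad z_L=\frac{y_L}{\sqrt L}=z_L^R+jz_L^I .$$ Then the estimator $\hat\theta=\frac1\omega\tan^{-1}(z_L^I/z_L^R)$ is asymptotically normal: $\sqrt L\,(\hat\theta-\theta)$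 converges in distribution, as $L\to\infty$, to the normal law with mean zero and variance $$\big(\mathrm{E}[|h_i|]\big)^{-2}\;\frac{\frac{\sigma_v^2}{P_T}+1-\varphi_\eta(2\omega)}{2\,\omega^2\,\varphi_\eta^2(\omega)}\ \ge 0$$ (the point mass at $0$ if this variance is $0$), that is, the variance without fading multiplied by the fading penalty $(\mathrm{E}|h_i|)^{-2}$. This holds for each of the following branches of the inverse tangent: 1. if $\varphi_\eta(\omega)>0$, with $\tan^{-1}(z_L^I/z_L^R)$ the phase of $z_L$ taken in $[c,c+2\pi)$, for every real $c$ with $c<\omega\theta<c+2\pi$; 2. if $\varphi_\eta(\omega)<0$, with $\tan^{-1}(z_L^I/z_L^R)$ the phase of $-z_L$ taken in $[c,c+2\pi)$, for every real $c$ with $c<\omega\theta<c+2\pi$; 3. if $\omega\theta<\pi/2$ (and $\varphi_\eta(\omega)\ne0$ of either sign), with $\tan^{-1}$ the principal inverse tangent, with values in $(-\pi/2,\pi/2)$. -/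

import Mathlib

open MeasureTheory ProbabilityTheory Filter
open scoped NNReal

noncomputable section

/-- The circularly symmetric complex Gaussian law `𝒞𝒩(0, s)` with total variance `s`: real and
imaginary parts are independent real Gaussians with mean `0` and variance `s / 2`. -/
def complexGaussian (s : ℝ≥0) : Measure ℂ :=
  ((gaussianReal 0 (s / 2)).prod (gaussianReal 0 (s / 2))).map
    (fun p : ℝ × ℝ => (p.1 : ℂ) + (p.2 : ℂ) * Complex.I)

/-- The measurement `x = θ + η` of a sensor with sensing noise `η`. -/
def measurement (θ η : ℝ) : ℝ := θ + η

/-- The signal `y_L = √ρ ∑ |h_i| exp(j ω x_i) + v` received from the first `L` sensors over the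
fading multiple access channel; `h` are the channel coefficients, `x` the measurements, `v` the
channel noise, and `ρ` the per-sensor power. -/
def receivedSignal (ρ ω : ℝ) (h : ℕ → ℂ) (x : ℕ → ℝ) (v : ℂ) (L : ℕ) : ℂ :=
  (Real.sqrt ρ : ℂ) *
    ∑ i ∈ Finset.range L, (‖h i‖ : ℂ) * Complex.exp (Complex.I * (ω : ℂ) * (x i : ℂ)) + v

/-- The normalized received signal `z_L = y_L / √L` under the total power constraint
`ρ = PT / L`, when the parameter is `θ` and the sensing noises are `η`. -/
def normalizedSignal (PT ω θ : ℝ) (h : ℕ → ℂ) (η : ℕ → ℝ) (v : ℂ) (L : ℕ) : ℂ :=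
  receivedSignal (PT / L) ω h (fun i => measurement θ (η i)) v L / (Real.sqrt L : ℂ)

/-- The estimator `ω⁻¹ tan⁻¹(z^I / z^R)`, with `tan⁻¹` the principal inverse tangent, whose values
lie in `(-π/2, π/2)`. -/
def arctanEstimator (ω : ℝ) (z : ℂ) : ℝ := Real.arctan (z.im / z.re) / ω

/-- The estimator `ω⁻¹ tan⁻¹(z^I / z^R)`, with `tan⁻¹(z^I / z^R)` the phase of `z = z^R + j z^I`
(the inverse tangent resolved by the quadrant of `z`), taken in the window `[c, c + 2π)`. -/
def phaseEstimator (ω c : ℝ) (z : ℂ) : ℝ := toIcoMod Real.two_pi_pos c (Complex.arg z) / ω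

/-- The characteristic function `t ↦ E[exp(j t X)]` of a symmetric real random variable `X`, as a
real-valued function (by symmetry the imaginary part vanishes). -/
def symmCharFun {Ω : Type*} [MeasurableSpace Ω] (P : Measure Ω) (X : Ω → ℝ) (t : ℝ) : ℝ :=
  (charFun (P.map X) t).re

/-- The asymptotic variance without fading,
`[σ_v² / PT + 1 - φ(2ω)] / (2 ω² φ(ω)²)`. -/
def asymptoticVariance (σv2 PT : ℝ) (φ : ℝ → ℝ) (ω : ℝ) : ℝ :=
  (σv2 / PT + 1 - φ (2 * ω)) / (2 * ω ^ 2 * φ ω ^ 2)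

/-- The estimators `T L` of `θ` are asymptotically normal with variance `V`: `V ≥ 0` and
`√L (T L - θ)` converges in distribution to the normal law `𝒩(0, V)` as `L → ∞`
(the point mass at `0` when `V = 0`). -/
def AsymptoticallyNormal {Ω : Type*} [MeasurableSpace Ω] (P : Measure Ω) [IsProbabilityMeasure P]
    (T : ℕ → Ω → ℝ) (θ V : ℝ) : Prop :=
  0 ≤ V ∧
    TendstoInDistribution (fun (L : ℕ) (x : Ω) => Real.sqrt L * (T L x - θ)) atTop
      (id : ℝ → ℝ) (fun _ => P) (gaussianReal 0 V.toNNReal)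

end

/-! Rotate the received signal back by the true phase: `z L = exp(I ω θ) * W L`. By the law of large
numbers `W L` tends in probability to the real number `m = √PT · E|h| · φ(ω)`, which is nonzero. Its
imaginary part is centred, and `√L · Im (W L)` is `√PT` times a normalized i.i.d. sum of `|h i|
sin(ω η i)` plus independent Gaussian noise. The central limit theorem gives it the limiting
variance `PT (1 - φ(2ω)) / 2 + σv2 / 2`. Since `E|h|² = 1`, fading does not affect this variance; it
enters only through `m`.

Near `m`, on each branch, the estimation error is exactly `Im w · r w` with `r = phaseErrorFactor ω`
continuous at `m` and `r m = 1 / (m ω)`. Slutsky's theorem then multiplies the variance by `r m ^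
2`. The branches differ only in the proof of this local identity. -/

/-! ### Convergence in probability to a constant -/

open scoped Topology in
theorem tendsto_measure_notMem_of_tendstoInMeasure_const {Ω E ι : Type*} [MeasurableSpace Ω]
    [PseudoMetricSpace E] {P : Measure Ω} {l : Filter ι} {W : ι → Ω → E} {a : E}
    (h : TendstoInMeasure P W l (fun _ => a)) {U : Set E} (hU : U ∈ 𝓝 a) :
    Tendsto (fun n => P {x | W n x ∉ U}) l (𝓝 0) := by
  obtain ⟨ε, hε, hball⟩ := EMetric.mem_nhds_iff.1 hU
  refine tendsto_of_tendsto_of_tendsto_of_le_of_le tendsto_const_nhds (h ε hε)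
    (fun _ => zero_le) fun n => measure_mono fun x hx => ?_
  by_contra hlt
  exact hx (hball (Metric.mem_eball.2 (not_le.1 hlt)))

theorem tendstoInMeasure_const_comp_of_continuousAt {Ω E F ι : Type*} [MeasurableSpace Ω]
    [PseudoMetricSpace E] [PseudoMetricSpace F] {P : Measure Ω} {l : Filter ι} {W : ι → Ω → E}
    {a : E} (h : TendstoInMeasure P W l (fun _ => a)) {g : E → F} (hg : ContinuousAt g a) :
    TendstoInMeasure P (fun n x => g (W n x)) l (fun _ => g a) := by
  intro ε hε
  have hU : g ⁻¹' Metric.eball (g a) ε ∈ nhds a := hg (Metric.eball_mem_nhds _ hε)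
  refine (tendsto_measure_notMem_of_tendstoInMeasure_const h hU).congr fun n => ?_
  congr 1
  ext x
  simp [Metric.mem_eball]

/-- Lets an identity valid only near the limit point replace a global one: the exceptional event has
vanishing probability, however large `D` is there. -/
theorem tendstoInMeasure_zero_of_eq_zero_of_mem {Ω E F ι : Type*} [MeasurableSpace Ω]
    [PseudoMetricSpace E] [SeminormedAddCommGroup F] {P : Measure Ω} {l : Filter ι}
    {W : ι → Ω → E} {a : E} (h : TendstoInMeasure P W l (fun _ => a)) {U : Set E}
    (hU : U ∈ nhds a) {D : ι → Ω → F} (hD : ∀ᶠ n in l, ∀ x, W n x ∈ U → D n x = 0) :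
    TendstoInMeasure P D l 0 := by
  intro ε hε
  refine tendsto_of_tendsto_of_tendsto_of_le_of_le' tendsto_const_nhds
    (tendsto_measure_notMem_of_tendstoInMeasure_const h hU)
    (Eventually.of_forall fun _ => zero_le) (hD.mono fun n hn => measure_mono fun x hx hW => ?_)
  simp only [Set.mem_ofPred_eq, hn x hW, Pi.zero_apply, edist_self] at hx
  exact hε.not_ge hx

theorem tendstoInMeasure_add {Ω E ι : Type*} [MeasurableSpace Ω] [SeminormedAddCommGroup E]
    {P : Measure Ω} {l : Filter ι} {X Y : ι → Ω → E} {Z W : Ω → E}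
    (hX : TendstoInMeasure P X l Z) (hY : TendstoInMeasure P Y l W) :
    TendstoInMeasure P (fun n x => X n x + Y n x) l (fun x => Z x + W x) := by
  rw [tendstoInMeasure_iff_norm] at *
  intro ε hε
  have hsum := (hX (ε / 2) (half_pos hε)).add (hY (ε / 2) (half_pos hε))
  rw [add_zero] at hsum
  refine tendsto_of_tendsto_of_tendsto_of_le_of_le tendsto_const_nhds hsum
    (fun _ => zero_le) fun n => (measure_mono fun x hx => ?_).trans (measure_union_le _ _)
  simp only [Set.mem_union, Set.mem_ofPred_eq] at hx ⊢
  by_contra! hlt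
  have := norm_add_le (X n x - Z x) (Y n x - W x)
  rw [← add_sub_add_comm] at this
  linarith

/-- A sequence of identically distributed variables divided by `√n` vanishes in probability. -/
theorem tendstoInMeasure_inv_sqrt_smul_of_identDistrib {Ω E : Type*} [MeasurableSpace Ω]
    [NormedAddCommGroup E] [NormedSpace ℝ E] [MeasurableSpace E] [BorelSpace E]
    [SecondCountableTopology E]
    {P : Measure Ω} [IsFiniteMeasure P] {v : ℕ → Ω → E}
    (hv : ∀ n, IdentDistrib (v n) (v 0) P P) :
    TendstoInMeasure P (fun (n : ℕ) x => (Real.sqrt n)⁻¹ • v n x) atTop (fun _ => 0) := by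
  have h0 : TendstoInMeasure P (fun (n : ℕ) x => (Real.sqrt n)⁻¹ • v 0 x) atTop (fun _ => 0) := by
    refine tendstoInMeasure_of_tendsto_ae (fun n =>
      ((hv 0).aemeasurable_fst.const_smul _).aestronglyMeasurable) (ae_of_all _ fun x => ?_)
    have : Tendsto (fun n : ℕ => (Real.sqrt n)⁻¹) atTop (nhds 0) :=
      tendsto_inv_atTop_zero.comp (Real.tendsto_sqrt_atTop.comp tendsto_natCast_atTop_atTop)
    simpa using this.smul_const (v 0 x)
  -- Only the law of `v n` enters each probability, so the pointwise limit for the fixed variable `v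
  -- 0` suffices; no joint law is needed.
  intro ε hε
  refine (h0 ε hε).congr fun n => ?_
  have hm : MeasurableSet {y : E | ε ≤ edist ((Real.sqrt n)⁻¹ • y) 0} :=
    measurableSet_le measurable_const (by fun_prop)
  exact ((hv n).measure_mem_eq hm).symm

/-! ### Limits in distribution -/

/-- Adding independent Gaussian noise to a sequence that is asymptotically Gaussian. -/
theorem tendstoInDistribution_add_gaussian {Ω : Type*} [MeasurableSpace Ω] {P : Measure Ω}
    [IsProbabilityMeasure P] {X B : ℕ → Ω → ℝ} {s t : ℝ≥0}
    (hX : TendstoInDistribution X atTop (id : ℝ → ℝ) (fun _ => P) (gaussianReal 0 s))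
    (hB : ∀ n, HasLaw (B n) (gaussianReal 0 t) P) (hXB : ∀ n, IndepFun (X n) (B n) P) :
    TendstoInDistribution (fun n x => X n x + B n x) atTop (id : ℝ → ℝ) (fun _ => P)
      (gaussianReal 0 (s + t)) where
  forall_aemeasurable n := (hX.forall_aemeasurable n).add (hB n).aemeasurable
  tendsto := by
    -- Lévy continuity: the noise contributes a factor that does not depend on `n`.
    refine ProbabilityMeasure.tendsto_iff_tendsto_charFun.2 fun u => ?_
    have h := ProbabilityMeasure.tendsto_iff_tendsto_charFun.1 hX.tendsto u
    simp only [ProbabilityMeasure.coe_mk, Measure.map_id] at h ⊢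
    have hlim : charFun (gaussianReal 0 (s + t)) u =
        charFun (gaussianReal 0 s) u * charFun (gaussianReal 0 t) u := by
      simp only [charFun_gaussianReal, ← Complex.exp_add]
      congr 1
      push_cast
      ring
    rw [hlim]
    refine (h.mul_const _).congr fun n => ?_
    rw [(hXB n).charFun_map_fun_add_eq_mul (hX.forall_aemeasurable n) (hB n).aemeasurable,
      (hB n).map_eq, Pi.mul_apply]

theorem tendstoInDistribution_id_of_hasLaw {Ω Ω' E ι : Type*} [MeasurableSpace Ω]
    [MeasurableSpace Ω'] [TopologicalSpace E] [MeasurableSpace E] [OpensMeasurableSpace E]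
    {P : Measure Ω} [IsProbabilityMeasure P] {μ : Measure Ω'} [IsProbabilityMeasure μ]
    {ν : Measure E} [IsProbabilityMeasure ν] {l : Filter ι} {X : ι → Ω → E} {Z : Ω' → E}
    (hX : TendstoInDistribution X l Z (fun _ => P) μ) (hZ : HasLaw Z ν μ) :
    TendstoInDistribution X l (id : E → E) (fun _ => P) ν where
  forall_aemeasurable := hX.forall_aemeasurable
  tendsto := by
    have h : (⟨ν.map id, Measure.isProbabilityMeasure_map aemeasurable_id⟩ :
        ProbabilityMeasure E) =
        ⟨μ.map Z, Measure.isProbabilityMeasure_map hX.aemeasurable_limit⟩ :=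
      Subtype.ext (Measure.map_id.trans hZ.map_eq.symm)
    rw [h]
    exact hX.tendsto

/-- Delta method in the direction of the imaginary axis. -/
theorem asymptoticallyNormal_comp_of_eventually_eq {Ω : Type*} [MeasurableSpace Ω] {P : Measure Ω}
    [IsProbabilityMeasure P] {W : ℕ → Ω → ℂ} (hW_meas : ∀ n, Measurable (W n)) {a : ℂ}
    (hW : TendstoInMeasure P W atTop (fun _ => a)) {A : ℕ → Ω → ℝ} {s : ℝ≥0}
    (hA : TendstoInDistribution A atTop (id : ℝ → ℝ) (fun _ => P) (gaussianReal 0 s))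
    (hAW : ∀ᶠ n : ℕ in atTop, ∀ x, Real.sqrt n * (W n x).im = A n x)
    {g r : ℂ → ℝ} {θ : ℝ} (hg : Measurable g) (hr : Measurable r) (hra : ContinuousAt r a)
    (hgr : ∀ᶠ w in nhds a, g w - θ = w.im * r w) {V : ℝ} (hV : r a ^ 2 * s = V) :
    AsymptoticallyNormal P (fun n x => g (W n x)) θ V := by
  refine ⟨hV ▸ by positivity, ?_⟩
  -- Slutsky: `r (W n)` tends to the constant `r a` in probability.
  have hmul := hA.continuous_comp_prodMk_of_tendstoInMeasure_const (g := fun p : ℝ × ℝ => p.1 * p.2)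
    (by fun_prop) (tendstoInMeasure_const_comp_of_continuousAt hW hra)
    (fun n => (hr.comp (hW_meas n)).aemeasurable)
  have hlaw : HasLaw (fun y : ℝ => y * r a) (gaussianReal 0 V.toNNReal) (gaussianReal 0 s) := by
    refine ⟨by fun_prop, ?_⟩
    rw [gaussianReal_map_mul_const, mul_zero]
    congr 1
    rw [← hV, ← NNReal.coe_inj, Real.coe_toNNReal _ (by positivity)]
    simp
  have hlim := tendstoInDistribution_id_of_hasLaw hmul hlaw
  refine tendstoInDistribution_of_tendstoInMeasure_sub _ _ hlim ?_ fun n =>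
    (((hg.comp (hW_meas n)).sub_const θ).const_mul _).aemeasurable
  refine tendstoInMeasure_zero_of_eq_zero_of_mem hW hgr (hAW.mono fun n hn x hx => ?_)
  simp only [Set.mem_ofPred_eq] at hx
  simp only [Pi.sub_apply, hx, ← hn x]
  ring

/-! ### Branches of the inverse tangent -/

theorem Complex.arctan_im_div_re_eq_arg {w : ℂ} (hw : 0 < w.re) :
    Real.arctan (w.im / w.re) = w.arg := by
  have h := abs_lt.1 (Complex.abs_arg_lt_pi_div_two_iff.2 (Or.inl hw))
  rw [← Complex.tan_arg, Real.arctan_tan h.1 h.2]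

theorem toIcoMod_arg_exp_mul {w : ℂ} (hw : 0 < w.re) {c α : ℝ}
    (hc : α + Real.arctan (w.im / w.re) ∈ Set.Ico c (c + 2 * Real.pi)) :
    toIcoMod Real.two_pi_pos c (Complex.arg (Complex.exp (Complex.I * α) * w)) =
      α + Real.arctan (w.im / w.re) := by
  have hw0 : w ≠ 0 := by
    rintro rfl
    simp at hw
  refine (toIcoMod_eq_iff _).2 ⟨hc, ?_⟩
  have h : (Complex.arg (Complex.exp (Complex.I * α) * w) : Real.Angle) =
      ((α + w.arg : ℝ) : Real.Angle) := by
    rw [Complex.arg_mul_coe_angle (Complex.exp_ne_zero _) hw0, Real.Angle.coe_add, mul_comm,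
      Complex.arg_exp_mul_I, Real.Angle.coe_toIocMod]
  obtain ⟨k, hk⟩ := Real.Angle.angle_eq_iff_two_pi_dvd_sub.1 h
  refine ⟨k, ?_⟩
  rw [Complex.arctan_im_div_re_eq_arg hw, zsmul_eq_mul]
  linarith

/-- Write `w = k (cos a + I sin a)` with `k = w.re / cos a`. The factor `k` may be negative, but it
cancels in the quotient, so both signs of `w.re` are covered. -/
theorem arctan_im_div_re_exp_mul {w : ℂ} (hw : w.re ≠ 0) {α : ℝ}
    (hα : |α + Real.arctan (w.im / w.re)| < Real.pi / 2) :
    Real.arctan ((Complex.exp (Complex.I * α) * w).im / (Complex.exp (Complex.I * α) * w).re) =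
      α + Real.arctan (w.im / w.re) := by
  obtain ⟨h1, h2⟩ := abs_lt.1 hα
  rw [← Real.arctan_tan h1 h2]
  congr 1
  set a := Real.arctan (w.im / w.re) with ha
  have hcos : Real.cos a ≠ 0 := (Real.cos_arctan_pos _).ne'
  have htan : Real.sin a / Real.cos a = w.im / w.re := by
    rw [← Real.tan_eq_sin_div_cos, ha, Real.tan_arctan]
  have him : w.im = w.re / Real.cos a * Real.sin a := by
    field_simp at htan ⊢
    linarith
  have hre : w.re = w.re / Real.cos a * Real.cos a := by field_simp
  have hk : w.re / Real.cos a ≠ 0 := div_ne_zero hw hcos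
  rw [mul_comm Complex.I, Real.tan_eq_sin_div_cos, Real.sin_add, Real.cos_add]
  simp only [Complex.mul_im, Complex.mul_re, Complex.exp_ofReal_mul_I_re,
    Complex.exp_ofReal_mul_I_im]
  generalize w.re / Real.cos a = k at *
  rw [him, hre, ← mul_div_mul_left (Real.sin α * _ + _) _ hk]
  congr 1 <;> ring

theorem measurable_toIcoMod {p : ℝ} (hp : 0 < p) (c : ℝ) : Measurable (toIcoMod hp c) := by
  have : toIcoMod hp c = fun b => c + Int.fract ((b - c) / p) * p :=
    funext fun b => toIcoMod_eq_add_fract_mul hp c b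
  rw [this]
  fun_prop

theorem measurable_phaseEstimator (ω c : ℝ) : Measurable (phaseEstimator ω c) :=
  ((measurable_toIcoMod _ c).comp Complex.measurable_arg).div_const ω

theorem measurable_arctanEstimator (ω : ℝ) : Measurable (arctanEstimator ω) :=
  (Real.measurable_arctan.comp (Complex.measurable_im.div Complex.measurable_re)).div_const ω

theorem continuous_dslope_arctan : Continuous (dslope Real.arctan 0) := by
  rw [← continuousOn_univ, continuousOn_dslope univ_mem]
  exact ⟨Real.continuous_arctan.continuousOn, Real.differentiable_arctan 0⟩

/-- The factor `arctan (y / x) / (ω y)`, with its continuous extension to `y = 0`. -/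
noncomputable def phaseErrorFactor (ω : ℝ) (w : ℂ) : ℝ :=
  dslope Real.arctan 0 (w.im / w.re) / (w.re * ω)

theorem measurable_phaseErrorFactor (ω : ℝ) : Measurable (phaseErrorFactor ω) :=
  (continuous_dslope_arctan.measurable.comp (Complex.measurable_im.div Complex.measurable_re)).div
    (Complex.measurable_re.mul_const ω)

theorem continuousAt_phaseErrorFactor {ω : ℝ} (hω : ω ≠ 0) {a : ℂ} (ha : a.re ≠ 0) :
    ContinuousAt (phaseErrorFactor ω) a := by
  refine ContinuousAt.div ?_ (by fun_prop) (mul_ne_zero ha hω)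
  exact continuous_dslope_arctan.continuousAt.comp
    (Complex.continuous_im.continuousAt.div Complex.continuous_re.continuousAt ha)

theorem phaseErrorFactor_ofReal (ω m : ℝ) : phaseErrorFactor ω m = 1 / (m * ω) := by
  simp [phaseErrorFactor, dslope_same]

theorem im_mul_phaseErrorFactor {ω : ℝ} {w : ℂ} (hw : w.re ≠ 0) :
    w.im * phaseErrorFactor ω w = Real.arctan (w.im / w.re) / ω := by
  have h := sub_smul_dslope Real.arctan 0 (w.im / w.re)
  rw [sub_zero, Real.arctan_zero, sub_zero, smul_eq_mul] at h
  rw [← h, phaseErrorFactor]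
  field_simp

theorem tendsto_add_arctan_im_div_re {m : ℝ} (hm : m ≠ 0) (α : ℝ) :
    Tendsto (fun w : ℂ => α + Real.arctan (w.im / w.re)) (nhds (m : ℂ)) (nhds α) := by
  have h : ContinuousAt (fun w : ℂ => α + Real.arctan (w.im / w.re)) (m : ℂ) :=
    continuousAt_const.add (Real.continuous_arctan.continuousAt.comp
      (Complex.continuous_im.continuousAt.div Complex.continuous_re.continuousAt (by simpa)))
  simpa [ContinuousAt] using h

/-- The strict inequalities keep the phase away from the jump of the window for all `w` near `m`. -/
theorem eventually_phaseEstimator_sub_eq {ω : ℝ} (hω : ω ≠ 0) {θ c m : ℝ} (hm : 0 < m)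
    (hc : c < ω * θ) (hc' : ω * θ < c + 2 * Real.pi) :
    ∀ᶠ w : ℂ in nhds (m : ℂ),
      phaseEstimator ω c (Complex.exp (Complex.I * (ω * θ : ℝ)) * w) - θ =
        w.im * phaseErrorFactor ω w := by
  have hre : ∀ᶠ w : ℂ in nhds (m : ℂ), 0 < w.re :=
    Complex.continuous_re.continuousAt.eventually (lt_mem_nhds (by simpa))
  filter_upwards [hre, tendsto_add_arctan_im_div_re hm.ne' (ω * θ) (Ioo_mem_nhds hc hc')]
    with w hw hw'
  rw [im_mul_phaseErrorFactor hw.ne', phaseEstimator,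
    toIcoMod_arg_exp_mul hw (Set.Ioo_subset_Ico_self hw')]
  field_simp
  ring

theorem phaseErrorFactor_neg (ω : ℝ) (w : ℂ) : phaseErrorFactor ω (-w) = -phaseErrorFactor ω w := by
  rw [phaseErrorFactor, Complex.neg_im, Complex.neg_re, neg_div_neg_eq, neg_mul, div_neg,
    phaseErrorFactor]

theorem eventually_phaseEstimator_neg_sub_eq {ω : ℝ} (hω : ω ≠ 0) {θ c m : ℝ} (hm : m < 0)
    (hc : c < ω * θ) (hc' : ω * θ < c + 2 * Real.pi) :
    ∀ᶠ w : ℂ in nhds (m : ℂ),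
      phaseEstimator ω c (-(Complex.exp (Complex.I * (ω * θ : ℝ)) * w)) - θ =
        w.im * phaseErrorFactor ω w := by
  have h : Tendsto (fun w : ℂ => -w) (nhds (m : ℂ)) (nhds ((-m : ℝ) : ℂ)) := by
    rw [Complex.ofReal_neg]
    exact continuous_neg.continuousAt
  filter_upwards [h.eventually
    (eventually_phaseEstimator_sub_eq hω (neg_pos.2 hm) hc hc')] with w hw
  rw [← mul_neg, hw, phaseErrorFactor_neg, Complex.neg_im, neg_mul_neg]

theorem eventually_arctanEstimator_sub_eq {ω : ℝ} (hω : ω ≠ 0) {θ m : ℝ} (hm : m ≠ 0)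
    (hα : |ω * θ| < Real.pi / 2) :
    ∀ᶠ w : ℂ in nhds (m : ℂ),
      arctanEstimator ω (Complex.exp (Complex.I * (ω * θ : ℝ)) * w) - θ =
        w.im * phaseErrorFactor ω w := by
  have hre : ∀ᶠ w : ℂ in nhds (m : ℂ), w.re ≠ 0 :=
    Complex.continuous_re.continuousAt.eventually (isOpen_ne.mem_nhds (by simpa))
  filter_upwards [hre, (tendsto_add_arctan_im_div_re hm (ω * θ)).abs.eventually
    (gt_mem_nhds hα)] with w hw hw'
  rw [im_mul_phaseErrorFactor hw, arctanEstimator, arctan_im_div_re_exp_mul hw hw']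
  field_simp
  ring

/-! ### Gaussian noise and moments of the summands -/

/-- The imaginary part of a rotated circularly symmetric Gaussian variable is Gaussian. -/
theorem hasLaw_im_exp_mul_complexGaussian {Ω : Type*} [MeasurableSpace Ω] {P : Measure Ω}
    {v : Ω → ℂ} {s : ℝ≥0} (hv : HasLaw v (complexGaussian s) P) (α : ℝ) :
    HasLaw (fun x => (Complex.exp (Complex.I * α) * v x).im) (gaussianReal 0 (s / 2)) P := by
  have hrot : HasLaw (fun z : ℂ => (Complex.exp (Complex.I * α) * z).im) (gaussianReal 0 (s / 2))
      (complexGaussian s) := by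
    refine ⟨by fun_prop, ?_⟩
    rw [complexGaussian, Measure.map_map (by fun_prop) (by fun_prop)]
    -- The imaginary part is `a sin α + b cos α`, a sum of independent Gaussians whose variances add
    -- up to `s / 2`.
    have hind := indepFun_prod (μ := gaussianReal 0 (s / 2)) (ν := gaussianReal 0 (s / 2))
      (X := fun a => Real.sin α * a) (Y := fun b => Real.cos α * b) (by fun_prop) (by fun_prop)
    have hX : ((gaussianReal 0 (s / 2)).prod (gaussianReal 0 (s / 2))).map
        (fun p : ℝ × ℝ => Real.sin α * p.1) = _ :=
      (gaussianReal_const_mul (measurePreserving_fst.hasLaw) (Real.sin α)).map_eq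
    have hY : ((gaussianReal 0 (s / 2)).prod (gaussianReal 0 (s / 2))).map
        (fun p : ℝ × ℝ => Real.cos α * p.2) = _ :=
      (gaussianReal_const_mul (measurePreserving_snd.hasLaw) (Real.cos α)).map_eq
    convert gaussianReal_add_gaussianReal_of_indepFun hind hX hY using 1
    · congr 1
      ext p
      simp [Complex.mul_im, mul_comm Complex.I]
      ring
    · congr 1
      · simp
      · ext
        push_cast
        linear_combination -(s / 2 : ℝ) * Real.sin_sq_add_cos_sq α
  exact hrot.comp hv

theorem im_charFun_map_eq_zero_of_symm {Ω : Type*} [MeasurableSpace Ω] {P : Measure Ω} {X : Ω → ℝ}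
    (hX : IdentDistrib X (fun x => -X x) P P) (t : ℝ) : (charFun (P.map X) t).im = 0 := by
  have h : charFun (P.map X) t = charFun (P.map X) (-t) := by
    conv_lhs => rw [hX.map_eq]
    simp only [charFun_apply_real]
    rw [integral_map hX.aemeasurable_snd (by fun_prop),
      integral_map hX.aemeasurable_fst (by fun_prop)]
    simp
  rw [charFun_neg] at h
  exact Complex.conj_eq_iff_im.1 h.symm

theorem charFun_map_eq_symmCharFun {Ω : Type*} [MeasurableSpace Ω] {P : Measure Ω} {X : Ω → ℝ}
    (hX : IdentDistrib X (fun x => -X x) P P) (t : ℝ) :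
    charFun (P.map X) t = symmCharFun P X t :=
  Complex.ext rfl (by simp [im_charFun_map_eq_zero_of_symm hX])

theorem symmCharFun_eq_integral_cos {Ω : Type*} [MeasurableSpace Ω] {P : Measure Ω}
    [IsProbabilityMeasure P] {X : Ω → ℝ} (hX : AEMeasurable X P) (t : ℝ) :
    symmCharFun P X t = ∫ x, Real.cos (t * X x) ∂P := by
  have hint : Integrable (fun x => Complex.exp (t * X x * Complex.I)) P :=
    Integrable.of_bound (C := 1) (by fun_prop) (ae_of_all _ fun x => by
      rw [← Complex.ofReal_mul, Complex.norm_exp_ofReal_mul_I])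
  rw [symmCharFun, charFun_apply_real, integral_map hX (by fun_prop), ← RCLike.re_eq_complex_re,
    ← integral_re hint]
  refine integral_congr_ae (ae_of_all _ fun x => ?_)
  simp only [RCLike.re_eq_complex_re]
  rw [← Complex.ofReal_mul, Complex.exp_ofReal_mul_I_re]

theorem integral_sin_eq_zero_of_symm {Ω : Type*} [MeasurableSpace Ω] {P : Measure Ω}
    {X : Ω → ℝ} (hX : IdentDistrib X (fun x => -X x) P P) (t : ℝ) :
    ∫ x, Real.sin (t * X x) ∂P = 0 := by
  have h := (hX.comp (u := fun y => Real.sin (t * y)) (by fun_prop)).integral_eq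
  simp only [Function.comp_def, mul_neg, Real.sin_neg, integral_neg] at h
  linarith

theorem integral_sin_sq_eq {Ω : Type*} [MeasurableSpace Ω] {P : Measure Ω}
    [IsProbabilityMeasure P] {X : Ω → ℝ} (hX : AEMeasurable X P) (t : ℝ) :
    ∫ x, Real.sin (t * X x) ^ 2 ∂P = (1 - symmCharFun P X (2 * t)) / 2 := by
  have hint : Integrable (fun x => Real.cos (2 * t * X x)) P :=
    Integrable.of_bound (C := 1) (by fun_prop) (ae_of_all _ fun x => by
      simpa using Real.abs_cos_le_one _)
  rw [symmCharFun_eq_integral_cos hX]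
  calc ∫ x, Real.sin (t * X x) ^ 2 ∂P = ∫ x, (1 - Real.cos (2 * t * X x)) / 2 ∂P := by
        refine integral_congr_ae (ae_of_all _ fun x => ?_)
        simp only [mul_assoc 2 t, Real.cos_two_mul, Real.cos_sq']
        ring
    _ = _ := by
        rw [integral_div, integral_sub (integrable_const _) hint]
        simp

/-- The Bochner integral of a non-integrable function is `0`, so the value `1` already forces
integrability. -/
theorem memLp_two_of_integral_sq_eq_one {Ω : Type*} [MeasurableSpace Ω] {P : Measure Ω}
    {ρ : Ω → ℝ} (hρ : AEMeasurable ρ P)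
    (h1 : ∫ x, ρ x ^ 2 ∂P = 1) : MemLp ρ 2 P :=
  (memLp_two_iff_integrable_sq hρ.aestronglyMeasurable).2
    (Integrable.of_integral_ne_zero (by rw [h1]; exact one_ne_zero))

theorem integral_ne_zero_of_integral_sq_eq_one {Ω : Type*} [MeasurableSpace Ω] {P : Measure Ω}
    [IsProbabilityMeasure P] {ρ : Ω → ℝ} (hρ : AEMeasurable ρ P)
    (h0 : ∀ x, 0 ≤ ρ x) (h1 : ∫ x, ρ x ^ 2 ∂P = 1) : ∫ x, ρ x ∂P ≠ 0 := by
  intro h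
  have hint := (memLp_two_of_integral_sq_eq_one hρ h1).integrable (by norm_num)
  have hz := (integral_eq_zero_iff_of_nonneg h0 hint).1 h
  have : ∫ x, ρ x ^ 2 ∂P = 0 :=
    integral_eq_zero_of_ae (hz.mono fun x hx => by simp [hx])
  linarith

theorem memLp_two_mul_sin {Ω : Type*} [MeasurableSpace Ω] {P : Measure Ω}
    {ρ X : Ω → ℝ} (hρ : MemLp ρ 2 P) (hX : AEMeasurable X P) (t : ℝ) :
    MemLp (fun x => ρ x * Real.sin (t * X x)) 2 P :=
  hρ.of_le (hρ.aestronglyMeasurable.mul (by fun_prop)) (ae_of_all _ fun x => by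
    rw [norm_mul]
    exact mul_le_of_le_one_right (norm_nonneg _) (by simpa using Real.abs_sin_le_one _))

theorem integral_mul_sin_eq_zero {Ω : Type*} [MeasurableSpace Ω] {P : Measure Ω}
    {ρ X : Ω → ℝ} (hρ : AEMeasurable ρ P) (hXρ : IndepFun X ρ P)
    (hX : IdentDistrib X (fun x => -X x) P P) (t : ℝ) :
    ∫ x, ρ x * Real.sin (t * X x) ∂P = 0 := by
  rw [hXρ.symm.integral_fun_comp_mul_comp (f := fun y => y) (g := fun y => Real.sin (t * y))
    hρ hX.aemeasurable_fst (by fun_prop) (by fun_prop), integral_sin_eq_zero_of_symm hX, mul_zero]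

/-- The mean vanishes by symmetry, and the second moment factors by independence; the double-angle
formula produces `φ(2t)`. -/
theorem variance_mul_sin_eq {Ω : Type*} [MeasurableSpace Ω] {P : Measure Ω}
    [IsProbabilityMeasure P] {ρ X : Ω → ℝ} (hρ : AEMeasurable ρ P) (hXρ : IndepFun X ρ P)
    (hX : IdentDistrib X (fun x => -X x) P P) (h1 : ∫ x, ρ x ^ 2 ∂P = 1) (t : ℝ) :
    variance (fun x => ρ x * Real.sin (t * X x)) P = (1 - symmCharFun P X (2 * t)) / 2 := by
  have hXm := hX.aemeasurable_fst
  rw [variance_eq_integral (by fun_prop), integral_mul_sin_eq_zero hρ hXρ hX]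
  simp only [sub_zero, mul_pow]
  rw [hXρ.symm.integral_fun_comp_mul_comp (f := fun y => y ^ 2)
    (g := fun y => Real.sin (t * y) ^ 2) hρ hXm (by fun_prop) (by fun_prop), h1, one_mul,
    integral_sin_sq_eq hXm]

theorem integral_mul_exp_eq {Ω : Type*} [MeasurableSpace Ω] {P : Measure Ω}
    [IsProbabilityMeasure P] {ρ X : Ω → ℝ} (hρ : AEMeasurable ρ P) (hXρ : IndepFun X ρ P)
    (hX : IdentDistrib X (fun x => -X x) P P) (t : ℝ) :
    ∫ x, (ρ x : ℂ) * Complex.exp (Complex.I * t * X x) ∂P =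
      ((∫ x, ρ x ∂P) * symmCharFun P X t : ℝ) := by
  rw [hXρ.symm.integral_fun_comp_mul_comp (X := ρ) (Y := X) (f := fun y => (y : ℂ))
    (g := fun y : ℝ => Complex.exp (Complex.I * t * y)) hρ hX.aemeasurable_fst
    (by fun_prop) (by fun_prop), integral_complex_ofReal, Complex.ofReal_mul,
    ← charFun_map_eq_symmCharFun hX, charFun_apply_real,
    integral_map hX.aemeasurable_fst (by fun_prop)]
  congr 2
  ext x
  ring_nf

theorem integrable_mul_exp {Ω : Type*} [MeasurableSpace Ω] {P : Measure Ω}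
    {ρ X : Ω → ℝ} (hρ : Integrable ρ P) (hX : AEMeasurable X P) (t : ℝ) :
    Integrable (fun x => (ρ x : ℂ) * Complex.exp (Complex.I * t * X x)) P := by
  refine hρ.mono (by fun_prop) (ae_of_all _ fun x => ?_)
  rw [norm_mul, mul_assoc, ← Complex.ofReal_mul, Complex.norm_exp_I_mul_ofReal]
  simp

/-! ### Limit theorems for the sensor sums -/

/-- Central limit theorem for the sums `∑ ρ i * sin (t * X i)`. -/
theorem tendstoInDistribution_sum_mul_sin {Ω : Type*} [MeasurableSpace Ω] {P : Measure Ω}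
    [IsProbabilityMeasure P] {ρ X : ℕ → Ω → ℝ}
    (hind : iIndepFun (fun i x => (X i x, ρ i x)) P)
    (hident : ∀ i, IdentDistrib (fun x => (X i x, ρ i x)) (fun x => (X 0 x, ρ 0 x)) P P)
    (hρ : AEMeasurable (ρ 0) P) (hXρ : IndepFun (X 0) (ρ 0) P)
    (hX : IdentDistrib (X 0) (fun x => -X 0 x) P P) (h1 : ∫ x, ρ 0 x ^ 2 ∂P = 1) (t : ℝ) :
    TendstoInDistribution
      (fun (n : ℕ) x => (Real.sqrt n)⁻¹ * ∑ i ∈ Finset.range n, ρ i x * Real.sin (t * X i x))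
      atTop (id : ℝ → ℝ) (fun _ => P)
      (gaussianReal 0 ((1 - symmCharFun P (X 0) (2 * t)) / 2).toNNReal) := by
  have hu : Measurable (fun p : ℝ × ℝ => p.2 * Real.sin (t * p.1)) := by fun_prop
  have h := tendstoInDistribution_inv_sqrt_mul_sum_sub (P := P)
    (X := fun i x => ρ i x * Real.sin (t * X i x)) (Y := (id : ℝ → ℝ))
    (P' := gaussianReal 0 ((1 - symmCharFun P (X 0) (2 * t)) / 2).toNNReal)
    ⟨by fun_prop, by rw [Measure.map_id, variance_mul_sin_eq hρ hXρ hX h1]⟩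
    (memLp_two_mul_sin (memLp_two_of_integral_sq_eq_one hρ h1) hX.aemeasurable_fst t)
    (hind.comp (fun _ p => p.2 * Real.sin (t * p.1)) fun _ => hu)
    (fun i => (hident i).comp hu)
  simpa only [integral_mul_sin_eq_zero hρ hXρ hX, mul_zero, sub_zero] using h

/-- Law of large numbers for the averages of `ρ i * exp (I t (X i))`. -/
theorem tendstoInMeasure_average_mul_exp {Ω : Type*} [MeasurableSpace Ω] {P : Measure Ω}
    [IsProbabilityMeasure P] {ρ X : ℕ → Ω → ℝ}
    (hind : iIndepFun (fun i x => (X i x, ρ i x)) P)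
    (hident : ∀ i, IdentDistrib (fun x => (X i x, ρ i x)) (fun x => (X 0 x, ρ 0 x)) P P)
    (hρ : Integrable (ρ 0) P) (hXρ : IndepFun (X 0) (ρ 0) P)
    (hX : IdentDistrib (X 0) (fun x => -X 0 x) P P) (t : ℝ) :
    TendstoInMeasure P (fun (n : ℕ) x => (n : ℝ)⁻¹ •
        ∑ i ∈ Finset.range n, (ρ i x : ℂ) * Complex.exp (Complex.I * t * X i x)) atTop
      (fun _ => (((∫ x, ρ 0 x ∂P) * symmCharFun P (X 0) t : ℝ) : ℂ)) := by
  have hu : Measurable (fun p : ℝ × ℝ => (p.2 : ℂ) * Complex.exp (Complex.I * t * p.1)) := by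
    fun_prop
  have hmeas (i : ℕ) : AEMeasurable
      (fun x => (ρ i x : ℂ) * Complex.exp (Complex.I * t * X i x)) P :=
    hu.comp_aemeasurable (hident i).aemeasurable_fst
  have h := strong_law_ae (μ := P)
    (fun i x => (ρ i x : ℂ) * Complex.exp (Complex.I * t * X i x))
    (integrable_mul_exp hρ hX.aemeasurable_fst t)
    (fun i j hij => (hind.indepFun hij).comp hu hu) (fun i => (hident i).comp hu)
  rw [integral_mul_exp_eq hρ.aemeasurable hXρ hX] at h
  exact tendstoInMeasure_of_tendsto_ae (fun n =>
    (AEMeasurable.const_smul (Finset.aemeasurable_fun_sum _ fun i _ => hmeas i)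
      (n : ℝ)⁻¹).aestronglyMeasurable) h

/-! ### The derotated signal and the main theorem -/

/-- The normalized received signal, rotated back by the phase `ω θ` of the parameter. -/
noncomputable def derotatedSignal (PT ω θ : ℝ) (ρ : ℕ → ℝ) (η : ℕ → ℝ) (v : ℂ) (L : ℕ) : ℂ :=
  (Real.sqrt PT : ℂ) * ((L : ℝ)⁻¹ •
      ∑ i ∈ Finset.range L, (ρ i : ℂ) * Complex.exp (Complex.I * ω * η i)) +
    (Real.sqrt L)⁻¹ • (Complex.exp (Complex.I * (-(ω * θ) : ℝ)) * v)

theorem normalizedSignal_eq_exp_mul_derotatedSignal {PT : ℝ} (hPT : 0 ≤ PT) (ω θ : ℝ) (h : ℕ → ℂ)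
    (η : ℕ → ℝ) (v : ℂ) (L : ℕ) :
    normalizedSignal PT ω θ h η v L = Complex.exp (Complex.I * (ω * θ : ℝ)) *
      derotatedSignal PT ω θ (fun i => ‖h i‖) η v L := by
  have hexp : Complex.exp (Complex.I * (ω * θ : ℝ)) *
      Complex.exp (Complex.I * (-(ω * θ) : ℝ)) = 1 := by
    rw [← Complex.exp_add]
    simp
  have hsum : ∑ i ∈ Finset.range L, (‖h i‖ : ℂ) *
        Complex.exp (Complex.I * ω * (measurement θ (η i) : ℝ)) =
      Complex.exp (Complex.I * (ω * θ : ℝ)) *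
        ∑ i ∈ Finset.range L, (‖h i‖ : ℂ) * Complex.exp (Complex.I * ω * η i) := by
    rw [Finset.mul_sum]
    refine Finset.sum_congr rfl fun i _ => ?_
    rw [mul_left_comm, ← Complex.exp_add, measurement]
    congr 2
    push_cast
    ring
  have hL : (Real.sqrt L : ℂ)⁻¹ * (Real.sqrt L : ℂ)⁻¹ = (L : ℂ)⁻¹ := by
    rw [← mul_inv, ← Complex.ofReal_mul, Real.mul_self_sqrt L.cast_nonneg, Complex.ofReal_natCast]
  rw [normalizedSignal, receivedSignal, derotatedSignal, hsum, Real.sqrt_div hPT]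
  simp only [Complex.real_smul, Complex.ofReal_inv, Complex.ofReal_div, Complex.ofReal_natCast,
    ← hL]
  rw [mul_add, mul_left_comm _ (Real.sqrt L : ℂ)⁻¹, ← mul_assoc _ _ v, hexp]
  ring

/-- Positivity of `L` matters: at `L = 0` the left side is zero while the noise term on the right
remains. -/
theorem sqrt_mul_im_derotatedSignal {L : ℕ} (hL : 0 < L) (PT ω θ : ℝ) (ρ η : ℕ → ℝ) (v : ℂ) :
    Real.sqrt L * (derotatedSignal PT ω θ ρ η v L).im =
      Real.sqrt PT * ((Real.sqrt L)⁻¹ * ∑ i ∈ Finset.range L, ρ i * Real.sin (ω * η i)) +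
        (Complex.exp (Complex.I * (-(ω * θ) : ℝ)) * v).im := by
  have hsum : (∑ i ∈ Finset.range L, (ρ i : ℂ) * Complex.exp (Complex.I * ω * η i)).im =
      ∑ i ∈ Finset.range L, ρ i * Real.sin (ω * η i) := by
    rw [Complex.im_sum]
    refine Finset.sum_congr rfl fun i _ => ?_
    rw [Complex.im_ofReal_mul, mul_assoc, ← Complex.ofReal_mul, mul_comm Complex.I,
      Complex.exp_ofReal_mul_I_im]
  have hs : Real.sqrt L ≠ 0 := (Real.sqrt_pos.2 (by exact_mod_cast hL)).ne'
  have hLs : (L : ℝ)⁻¹ = (Real.sqrt L)⁻¹ * (Real.sqrt L)⁻¹ := by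
    rw [← mul_inv, Real.mul_self_sqrt L.cast_nonneg]
  rw [derotatedSignal, Complex.add_im, Complex.im_ofReal_mul, Complex.smul_im, Complex.smul_im,
    hsum, smul_eq_mul, smul_eq_mul, hLs]
  field_simp

theorem theorem8
    {Ω : Type*} [MeasurableSpace Ω] (P : Measure Ω) [IsProbabilityMeasure P]
    (θ θR ω PT : ℝ) (σv2 : ℝ≥0)
    (hθR : 0 < θR) (hθ : θ ∈ Set.Icc 0 θR)
    (hω : ω ∈ Set.Ioc 0 (2 * Real.pi / θR)) (hPT : 0 < PT)
    -- sensing noises `η i`, channel coefficients `h i`, channel noises `v L`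
    (η : ℕ → Ω → ℝ) (h : ℕ → Ω → ℂ) (v : ℕ → Ω → ℂ)
    (hη_meas : ∀ i, Measurable (η i)) (hh_meas : ∀ i, Measurable (h i))
    (hv_meas : ∀ L, Measurable (v L))
    -- the pairs `(η i, |h i|)` are i.i.d. with independent components
    (h_indep : iIndepFun (fun (i : ℕ) (x : Ω) => (η i x, ‖h i x‖)) P)
    (hη_ident : ∀ i, IdentDistrib (η i) (η 0) P P)
    (hh_ident : ∀ i, IdentDistrib (fun x => ‖h i x‖) (fun x => ‖h 0 x‖) P P)
    (hηh_indep : ∀ i, IndepFun (η i) (fun x => ‖h i x‖) P)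
    -- the sensing noise is symmetric
    (hη_symm : IdentDistrib (η 0) (fun x => -η 0 x) P P)
    -- the fading has unit second moment
    (hh_sq : ∫ x, ‖h 0 x‖ ^ 2 ∂P = 1)
    -- the channel noise is complex Gaussian and independent of sensing noise and fading
    (hv_law : ∀ L, HasLaw (v L) (complexGaussian σv2) P)
    (hv_indep : ∀ L, IndepFun (v L) (fun (x : Ω) (i : ℕ) => (η i x, ‖h i x‖)) P)
    (hφ : symmCharFun P (η 0) ω ≠ 0) :
    let z : ℕ → Ω → ℂ := fun L x =>
      normalizedSignal PT ω θ (fun i => h i x) (fun i => η i x) (v L x) L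
    let V : ℝ := (∫ x, ‖h 0 x‖ ∂P)⁻¹ ^ 2 *
      asymptoticVariance σv2 PT (symmCharFun P (η 0)) ω
    -- the quadrant-resolved inverse tangent, for any window around the true phase
    (0 < symmCharFun P (η 0) ω → ∀ c : ℝ, c < ω * θ → ω * θ < c + 2 * Real.pi →
      AsymptoticallyNormal P (fun L x => phaseEstimator ω c (z L x)) θ V) ∧
    -- the same for a negative characteristic function, where the phase is shifted by `π`
    (symmCharFun P (η 0) ω < 0 → ∀ c : ℝ, c < ω * θ → ω * θ < c + 2 * Real.pi →
      AsymptoticallyNormal P (fun L x => phaseEstimator ω c (-z L x)) θ V) ∧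
    -- the principal inverse tangent
    (ω * θ < Real.pi / 2 →
      AsymptoticallyNormal P (fun L x => arctanEstimator ω (z L x)) θ V) := by
  intro z V
  obtain ⟨hω0, -⟩ := hω
  obtain ⟨hθ0, -⟩ := hθ
  have hρ : ∀ i, Measurable fun x => ‖h i x‖ := fun i => (hh_meas i).norm
  have hident : ∀ i, IdentDistrib (fun x => (η i x, ‖h i x‖)) (fun x => (η 0 x, ‖h 0 x‖)) P P :=
    fun i => (hη_ident i).prodMk (hh_ident i) (hηh_indep i) (hηh_indep 0)
  have hmean : ∫ x, ‖h 0 x‖ ∂P ≠ 0 :=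
    integral_ne_zero_of_integral_sq_eq_one (hρ 0).aemeasurable (fun _ => norm_nonneg _) hh_sq
  have hmean_pos : 0 < ∫ x, ‖h 0 x‖ ∂P :=
    lt_of_le_of_ne (integral_nonneg fun _ => norm_nonneg _) hmean.symm
  have hint : Integrable (fun x => ‖h 0 x‖) P :=
    (memLp_two_of_integral_sq_eq_one (hρ 0).aemeasurable hh_sq).integrable (by norm_num)
  set φ := symmCharFun P (η 0) with hφ_def
  set m : ℝ := Real.sqrt PT * ((∫ x, ‖h 0 x‖ ∂P) * φ ω) with hm_def
  have hm_pos : 0 < Real.sqrt PT * ∫ x, ‖h 0 x‖ ∂P := mul_pos (Real.sqrt_pos.2 hPT) hmean_pos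
  have hm_eq : m = (Real.sqrt PT * ∫ x, ‖h 0 x‖ ∂P) * φ ω := by rw [hm_def, mul_assoc]
  have hm : m ≠ 0 := hm_eq ▸ mul_ne_zero hm_pos.ne' hφ
  let W : ℕ → Ω → ℂ := fun L x =>
    derotatedSignal PT ω θ (fun i => ‖h i x‖) (fun i => η i x) (v L x) L
  have hzW : ∀ L x, z L x = Complex.exp (Complex.I * (ω * θ : ℝ)) * W L x := fun L x =>
    normalizedSignal_eq_exp_mul_derotatedSignal hPT.le ω θ _ _ _ L
  have hW_meas : ∀ L, Measurable (W L) := by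
    intro L
    simp only [W, derotatedSignal]
    fun_prop
  have hW : TendstoInMeasure P W atTop (fun _ => (m : ℂ)) := by
    have h1 := tendstoInMeasure_const_comp_of_continuousAt
      (tendstoInMeasure_average_mul_exp h_indep hident hint (hηh_indep 0) hη_symm ω)
      (g := fun w => (Real.sqrt PT : ℂ) * w) (by fun_prop)
    have h2 := tendstoInMeasure_inv_sqrt_smul_of_identDistrib (P := P)
      (v := fun n x => Complex.exp (Complex.I * (-(ω * θ) : ℝ)) * v n x)
      (fun n => ((hv_law n).identDistrib (hv_law 0)).comp
        (u := fun y => Complex.exp (Complex.I * (-(ω * θ) : ℝ)) * y) (by fun_prop))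
    have h3 := tendstoInMeasure_add h1 h2
    simp only [add_zero, ← Complex.ofReal_mul] at h3
    exact h3
  let s : ℝ≥0 := ((1 - φ (2 * ω)) / 2).toNNReal
  have hs : (s : ℝ) = (1 - φ (2 * ω)) / 2 := by
    refine Real.coe_toNNReal _ ?_
    -- Being the mean of `sin²`, the value is nonnegative, so `toNNReal` does not truncate it.
    rw [← integral_sin_sq_eq (P := P) (hη_meas 0).aemeasurable ω]
    exact integral_nonneg fun _ => sq_nonneg _
  have hclt := tendstoInDistribution_sum_mul_sin h_indep hident (hρ 0).aemeasurable (hηh_indep 0)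
    hη_symm hh_sq ω
  have hclt' := tendstoInDistribution_id_of_hasLaw
    (hclt.continuous_comp (g := fun y => Real.sqrt PT * y) (by fun_prop))
    (gaussianReal_const_mul (X := id) HasLaw.id (Real.sqrt PT))
  rw [mul_zero] at hclt'
  have hA := tendstoInDistribution_add_gaussian hclt'
    (fun n => hasLaw_im_exp_mul_complexGaussian (hv_law n) (-(ω * θ))) (fun n => by
      have := (hv_indep n).symm.comp
        (φ := fun q : ℕ → ℝ × ℝ => Real.sqrt PT * ((Real.sqrt n)⁻¹ *
          ∑ i ∈ Finset.range n, (q i).2 * Real.sin (ω * (q i).1)))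
        (ψ := fun y : ℂ => (Complex.exp (Complex.I * (-(ω * θ) : ℝ)) * y).im)
        (by fun_prop) (by fun_prop)
      exact this)
  have key : ∀ g : ℂ → ℝ, Measurable g →
      (∀ᶠ w : ℂ in nhds (m : ℂ), g w - θ = w.im * phaseErrorFactor ω w) →
      AsymptoticallyNormal P (fun L x => g (W L x)) θ V := by
    intro g hg hgr
    refine asymptoticallyNormal_comp_of_eventually_eq hW_meas hW hA
      ((eventually_gt_atTop 0).mono fun n hn x => sqrt_mul_im_derotatedSignal hn _ _ _ _ _ _)
      hg (measurable_phaseErrorFactor ω)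
      (continuousAt_phaseErrorFactor hω0.ne' (by simpa using hm)) hgr ?_
    -- It remains to check `(1 / (m ω))² (PT (1 - φ(2ω)) / 2 + σv2 / 2) = V`.
    rw [phaseErrorFactor_ofReal, hm_eq]
    simp only [V, asymptoticVariance, ← hφ_def]
    push_cast
    rw [hs, Real.sq_sqrt hPT.le]
    have hsq := Real.sq_sqrt hPT.le
    field_simp
    rw [hsq]
    ring
  have hphase (c : ℝ) : Measurable (phaseEstimator ω c) := measurable_phaseEstimator ω c
  have harctan := measurable_arctanEstimator ω
  refine ⟨fun hpos c hc hc' => ?_, fun hneg c hc hc' => ?_, fun hα => ?_⟩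
  · simp only [hzW]
    exact key _ (by fun_prop) (eventually_phaseEstimator_sub_eq hω0.ne'
      (hm_eq ▸ mul_pos hm_pos hpos) hc hc')
  · simp only [hzW]
    exact key (fun w => phaseEstimator ω c (-(Complex.exp (Complex.I * (ω * θ : ℝ)) * w)))
      (by fun_prop) (eventually_phaseEstimator_neg_sub_eq hω0.ne'
      (hm_eq ▸ mul_neg_of_pos_of_neg hm_pos hneg) hc hc')
  · simp only [hzW]
    exact key _ (by fun_prop) (eventually_arctanEstimator_sub_eq hω0.ne' hm
      (by rwa [abs_of_nonneg (mul_nonneg hω0.le hθ0)]))
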